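/- \textbf{Wireless gathering.} An instance consists of a graph $G=(V,E)$ with distance $d$, a sink $s\in V$, an integer interference radius $d_I\ge 1$, and a finite set $J$ of packets; packet $j$ has an origin $o_j\in V$, from which $s$ is reachable, and a release date $r_j\in\mathbb Z_{\ge 0}$. Time is divided into rounds $0,1,2,\dots$. In a round, a packet held by $u$ may be sent to a neighbour $v$ (a call $(u,v)$), but not before the packet is released. Calls $(u,v)$, $(u',v')$ in the same round interfere if $d(u',v)\le d_I$ or $d(u,v')\le d_I$. A feasible schedule moves every packet from its origin to $s$ without interference between calls of different packets in the same round. At speed $\sigma$ a round lasts $1/\sigma$ time units, so round $t$ starts at time $t/\sigma$, and packet $j$ may be sent in it only if $r_j\le t/\sigma$. An unaugmented schedule has speed $1$. The completion time $C_j$ is the first time $\tau\ge r_j$ at which $j$ is held by $s$ (so $C_j=r_j$ if $o_j=s$), and the flow time is $F_j=C_j-r_j$. C-WGP asks to minimize $\max_j C_j$, F-WGP to minimize $\max_j F_j$. \textbf{FIFO.} Packets receive distinct priorities such that packets with earlier release dates have higher priority, ties being broken arbitrarily. In every round $t$, the available packets (those with release date at most $t$ that are not yet at $s$) are considered in order of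 decreasing priority; each is sent to the next node of an (arbitrarily chosen) shortest path from its current node to $s$, unless this call interferes with the call of a higher-priority packet sent in the same round. $\sigma$-FIFO replaces the release dates $r_j$ by $\sigma r_j$, runs FIFO, and executes the resulting sequence of rounds at speed $\sigma$. \textbf{Theorem.} Let $\gamma=d_I+2$ and $\gamma_0=\lfloor (d_I+1)/2\rfloor$, and let $\sigma\ge \gamma/\gamma_0+1$ be real. Then, for all choices of ties and shortest paths, $\sigma$-FIFO produces a feasible schedule of speed $\sigma$ for the original instance, and it is $\sigma$-speed optimal for both C-WGP and F-WGP: its maximum completion time is at most that of every feasible unaugmented schedule (in particular of one optimal for C-WGP), and its maximum flow time is at most that of every feasible unaugmented schedule (in particular of one optimal for F-WGP). -/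

import Mathlib

/-- An instance of the Wireless Gathering Problem: a graph on the node set `V`, a sink, a positive
interference radius, and packets `j : J` with an origin and an integer release date. -/
structure WGP (V J : Type*) where
  graph : SimpleGraph V
  sink : V
  dI : ℕ
  dI_pos : 0 < dI
  origin : J → V
  release : J → ℕ

namespace WGP

variable {V J : Type*}

/-- The calls `c = (u, v)` and `c' = (u', v')`, made in the same round, interfere:
`d(u', v) ≤ dI` or `d(u, v') ≤ dI`. (`edist` is the graph distance, infinite between different
connected components.) -/
def Interfere (I : WGP V J) (c c' : V × V) : Prop :=
  I.graph.edist c'.1 c.2 ≤ (I.dI : ℕ∞) ∨ I.graph.edist c.1 c'.2 ≤ (I.dI : ℕ∞)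

/-- In the schedule `x`, packet `j` is sent in round `t`. A schedule is given by the nodes `x t j`
holding packet `j` after `t` rounds (before round `t`). -/
def Moves (x : ℕ → J → V) (t : ℕ) (j : J) : Prop := x (t + 1) j ≠ x t j

/-- The call by which `j` is sent in round `t`, if it is sent. -/
def call (x : ℕ → J → V) (t : ℕ) (j : J) : V × V := (x t j, x (t + 1) j)

/-- `x` is a feasible schedule for `I` at speed `σ`: every round lasts `1 / σ` time units, so that
round `t` starts at time `t / σ`. Packets start at their origins, are sent only along edges and not
before their release dates, the calls made in one round are pairwise compatible, and every packet
reaches the sink. Ordinary (unaugmented) schedules are those of speed `1`. -/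
structure IsFeasible (I : WGP V J) (σ : ℝ) (x : ℕ → J → V) : Prop where
  start : ∀ j, x 0 j = I.origin j
  adj : ∀ t j, Moves x t j → I.graph.Adj (x t j) (x (t + 1) j)
  released : ∀ t j, Moves x t j → (I.release j : ℝ) ≤ (t : ℝ) / σ
  compatible : ∀ t j k, j ≠ k → Moves x t j → Moves x t k →
    ¬ I.Interfere (call x t j) (call x t k)
  delivered : ∀ j, ∃ t, x t j = I.sink

/-- The completion time of `j` in a schedule `x` of speed `σ`: the first time `τ` at which `j` is in
the network and is held by the sink. At time `τ` exactly `⌊σ τ⌋` rounds have been completed. -/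
noncomputable def completionTime (I : WGP V J) (σ : ℝ) (x : ℕ → J → V) (j : J) : ℝ :=
  sInf {τ : ℝ | (I.release j : ℝ) ≤ τ ∧ x ⌊σ * τ⌋₊ j = I.sink}

/-- The flow time of `j` in a schedule `x` of speed `σ`. -/
noncomputable def flowTime (I : WGP V J) (σ : ℝ) (x : ℕ → J → V) (j : J) : ℝ :=
  I.completionTime σ x j - I.release j

/-- The objective of C-WGP. -/
noncomputable def maxCompletionTime (I : WGP V J) (σ : ℝ) (x : ℕ → J → V) : ℝ :=
  ⨆ j, I.completionTime σ x j

/-- The objective of F-WGP. -/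
noncomputable def maxFlowTime (I : WGP V J) (σ : ℝ) (x : ℕ → J → V) : ℝ :=
  ⨆ j, I.flowTime σ x j

/-- One round (round `t`) of Priority Greedy with release dates `r`. A smaller `rank` means a higher
priority, `pos k` is the current node of packet `k`, and `next k` the node to which `k` would be sent.
Packets are considered in order of decreasing priority, and `j` is sent if it is available (released
and not yet at the sink) and its call does not interfere with the call of any packet of higher
priority that is sent in this round. -/
def greedySent (I : WGP V J) (r : J → ℝ) (rank : J → ℕ) (t : ℕ) (pos next : J → V) (j : J) : Prop :=
  r j ≤ (t : ℝ) ∧ pos j ≠ I.sink ∧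
    ∀ k, rank k < rank j → greedySent I r rank t pos next k →
      ¬ I.Interfere (pos k, next k) (pos j, next j)
termination_by rank j

open Classical in
/-- The schedule (at unit speed) that Priority Greedy computes for the network and the packet origins
of `I` with the release dates `r`, where `hop t j u` is the node to which packet `j` is to be sent
next if it is held by node `u` in round `t`. -/
noncomputable def priorityGreedy (I : WGP V J) (r : J → ℝ) (rank : J → ℕ) (hop : ℕ → J → V → V) :
    ℕ → J → V
  | 0 => I.origin
  | t + 1 => fun j =>
      if I.greedySent r rank t (priorityGreedy I r rank hop t)
          (fun k => hop t k (priorityGreedy I r rank hop t k)) j then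
        hop t j (priorityGreedy I r rank hop t j)
      else priorityGreedy I r rank hop t j

/-- `hop` always proposes the next node of some shortest path to the sink. The choice of the shortest
path is arbitrary, and may change with the packet and the round. -/
def IsShortestPathRule (I : WGP V J) (hop : ℕ → J → V → V) : Prop :=
  ∀ t j u, u ≠ I.sink → I.graph.Reachable u I.sink →
    I.graph.Adj u (hop t j u) ∧
      I.graph.edist (hop t j u) I.sink + 1 = I.graph.edist u I.sink

/-- Unique priorities of FIFO for the release dates `r`: earlier released packets have higher priority
(smaller rank), ties are broken arbitrarily. -/
def IsFIFORank (r : J → ℝ) (rank : J → ℕ) : Prop :=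
  Function.Injective rank ∧ ∀ j k, r j < r k → rank j < rank k

/-- The release dates `σ r_j` of the modified instance. -/
def scaledRelease (I : WGP V J) (σ : ℝ) (j : J) : ℝ := σ * (I.release j : ℝ)

/-- The schedule of `σ`-FIFO: FIFO is run with the release dates `σ r_j`. Speeding up the result by
`σ` means executing the same sequence of rounds with rounds of length `1 / σ`, that is, regarding it
as a schedule of speed `σ` for `I`. -/
noncomputable def sigmaFIFO (I : WGP V J) (σ : ℝ) (rank : J → ℕ) (hop : ℕ → J → V → V) :
    ℕ → J → V :=
  I.priorityGreedy (I.scaledRelease σ) rank hop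

/-- The parameter `γ = dI + 2`. -/
def gamma (I : WGP V J) : ℕ := I.dI + 2

/-- The parameter `γ₀ = ⌊(dI + 1) / 2⌋`. -/
def gammaZero (I : WGP V J) : ℕ := (I.dI + 1) / 2

end WGP

/-!
The proof compares an upper bound for FIFO with a lower bound for every schedule. Write `δ k` for the
distance of the origin of packet `k` from the sink.

*Upper bound.* If, in some round, packet `j` is blocked by a packet `k` of higher priority, then `j`
is at most `dI + 1` farther from the sink than `k`. From the last such round on, `j` moves in every
round, so it arrives at most `min (δ j) γ` rounds after `k`. Following blocking packets upwards
through the priorities one reaches a packet `i` that is delayed only by its own release date. Hence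
`j` arrives by round `⌈r i⌉ + δ i + ∑ min (δ k) γ`, the sum being over the other packets of the chain
(`priorityGreedy_arrival`).

*Lower bound.* Two calls that both lead from distance `a ≤ γ₀` to distance `a - 1` of the sink
(with possibly different `a`) interfere, because `2 γ₀ - 1 ≤ dI`. A packet `k` needs `min (δ k) γ₀`
such calls, so a set `K` of packets none of which is released before time `R` cannot be delivered
before time `R + ∑ k ∈ K, min (δ k) γ₀` (`IsFeasible.add_sum_le`).

*Comparison.* Let `T` be the time at which an unaugmented schedule has delivered every packet of
priority at least that of `j`. As `min (δ k) γ ≤ (γ / γ₀) min (δ k) γ₀`, and as `T` is at least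
`r i + δ i` and at least the lower bound, the chain bound for the release dates `σ r` is at most
`σ T` (`chainBound_le_mul`). Thus `σ`-FIFO completes `j` by time `T`, which is the completion time, in
the unaugmented schedule, of some packet released no later than `j`; this gives both objectives.
-/

namespace WGP

variable {V J : Type*}

/-! ### Distances to the sink -/

/-- The distance from `u` to the sink. It is meaningful only for nodes from which the sink is
reachable. -/
noncomputable def sinkDist (I : WGP V J) (u : V) : ℕ := I.graph.dist u I.sink

/-- The distance from the origin of packet `j` to the sink. -/
noncomputable def delta (I : WGP V J) (j : J) : ℕ := I.sinkDist (I.origin j)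

theorem coe_sinkDist (I : WGP V J) {u : V} (h : I.graph.Reachable u I.sink) :
    (I.sinkDist u : ℕ∞) = I.graph.edist u I.sink :=
  h.coe_dist_eq_edist

theorem sinkDist_eq_zero (I : WGP V J) {u : V} (h : I.graph.Reachable u I.sink) :
    I.sinkDist u = 0 ↔ u = I.sink :=
  h.dist_eq_zero_iff

@[simp]
theorem sinkDist_sink (I : WGP V J) : I.sinkDist I.sink = 0 :=
  SimpleGraph.dist_self

theorem sinkDist_le_add (I : WGP V J) {u v : V} {n : ℕ} (hu : I.graph.Reachable u I.sink)
    (hv : I.graph.Reachable v I.sink) (h : I.graph.edist u v ≤ n) :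
    I.sinkDist u ≤ n + I.sinkDist v := by
  have h1 := SimpleGraph.edist_triangle (G := I.graph) (u := u) (v := v) (w := I.sink)
  rw [← I.coe_sinkDist hu, ← I.coe_sinkDist hv] at h1
  have h2 : (I.sinkDist u : ℕ∞) ≤ n + I.sinkDist v := h1.trans (by gcongr)
  exact_mod_cast h2

theorem edist_le_sinkDist_add (I : WGP V J) {u v : V} (hu : I.graph.Reachable u I.sink)
    (hv : I.graph.Reachable v I.sink) :
    I.graph.edist u v ≤ ((I.sinkDist u + I.sinkDist v : ℕ) : ℕ∞) := by
  have h1 := SimpleGraph.edist_triangle (G := I.graph) (u := u) (v := I.sink) (w := v)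
  rwa [SimpleGraph.edist_comm (u := I.sink), ← I.coe_sinkDist hu, ← I.coe_sinkDist hv,
    ← Nat.cast_add] at h1

theorem sinkDist_le_succ_of_adj (I : WGP V J) {u v : V} (hu : I.graph.Reachable u I.sink)
    (h : I.graph.Adj u v) : I.sinkDist u ≤ I.sinkDist v + 1 := by
  have := I.sinkDist_le_add (n := 1) hu (h.reachable.symm.trans hu)
    (by simp [SimpleGraph.edist_eq_one_iff_adj.mpr h])
  omega

theorem interfere_comm (I : WGP V J) (c c' : V × V) : I.Interfere c c' ↔ I.Interfere c' c :=
  Or.comm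

theorem gammaZero_pos (I : WGP V J) : 0 < I.gammaZero := by
  have := I.dI_pos
  unfold gammaZero
  omega

theorem IsShortestPathRule.reachable {I : WGP V J} {hop : ℕ → J → V → V}
    (h : I.IsShortestPathRule hop) {t : ℕ} {j : J} {u : V} (hu : u ≠ I.sink)
    (hr : I.graph.Reachable u I.sink) : I.graph.Reachable (hop t j u) I.sink :=
  (h t j u hu hr).1.reachable.symm.trans hr

theorem IsShortestPathRule.sinkDist {I : WGP V J} {hop : ℕ → J → V → V}
    (h : I.IsShortestPathRule hop) {t : ℕ} {j : J} {u : V} (hu : u ≠ I.sink)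
    (hr : I.graph.Reachable u I.sink) : I.sinkDist (hop t j u) + 1 = I.sinkDist u := by
  have h1 := (h t j u hu hr).2
  rw [← I.coe_sinkDist hr, ← I.coe_sinkDist (h.reachable hu hr)] at h1
  exact_mod_cast h1

/-! ### The schedule of Priority Greedy -/

section Greedy

variable (I : WGP V J) (r : J → ℝ) (rank : J → ℕ) (hop : ℕ → J → V → V)

/-- Packet `j` is sent in round `t` of the schedule of Priority Greedy. -/
def IsSent (t : ℕ) (j : J) : Prop :=
  I.greedySent r rank t (I.priorityGreedy r rank hop t)
    (fun k => hop t k (I.priorityGreedy r rank hop t k)) j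

theorem isSent_iff (t : ℕ) (j : J) : I.IsSent r rank hop t j ↔
    r j ≤ (t : ℝ) ∧ I.priorityGreedy r rank hop t j ≠ I.sink ∧
      ∀ k, rank k < rank j → I.IsSent r rank hop t k →
        ¬ I.Interfere
          (I.priorityGreedy r rank hop t k, hop t k (I.priorityGreedy r rank hop t k))
          (I.priorityGreedy r rank hop t j, hop t j (I.priorityGreedy r rank hop t j)) := by
  unfold IsSent
  rw [greedySent]

theorem priorityGreedy_succ_of_isSent {t : ℕ} {j : J} (h : I.IsSent r rank hop t j) :
    I.priorityGreedy r rank hop (t + 1) j = hop t j (I.priorityGreedy r rank hop t j) := by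
  rw [priorityGreedy]
  exact if_pos h

theorem priorityGreedy_succ_of_not_isSent {t : ℕ} {j : J} (h : ¬ I.IsSent r rank hop t j) :
    I.priorityGreedy r rank hop (t + 1) j = I.priorityGreedy r rank hop t j := by
  rw [priorityGreedy]
  exact if_neg h

theorem isSent_of_moves {t : ℕ} {j : J} (h : Moves (I.priorityGreedy r rank hop) t j) :
    I.IsSent r rank hop t j := by
  by_contra hn
  exact h (I.priorityGreedy_succ_of_not_isSent r rank hop hn)

theorem reachable_priorityGreedy (hhop : I.IsShortestPathRule hop)
    (hreach : ∀ j, I.graph.Reachable (I.origin j) I.sink) (t : ℕ) (j : J) :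
    I.graph.Reachable (I.priorityGreedy r rank hop t j) I.sink := by
  induction t with
  | zero => exact hreach j
  | succ t ih =>
    by_cases h : I.IsSent r rank hop t j
    · rw [I.priorityGreedy_succ_of_isSent r rank hop h]
      exact hhop.reachable ((I.isSent_iff r rank hop t j).1 h).2.1 ih
    · rwa [I.priorityGreedy_succ_of_not_isSent r rank hop h]

theorem sinkDist_priorityGreedy_of_isSent (hhop : I.IsShortestPathRule hop)
    (hreach : ∀ j, I.graph.Reachable (I.origin j) I.sink) {t : ℕ} {j : J}
    (h : I.IsSent r rank hop t j) :
    I.sinkDist (I.priorityGreedy r rank hop (t + 1) j) + 1 =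
      I.sinkDist (I.priorityGreedy r rank hop t j) := by
  rw [I.priorityGreedy_succ_of_isSent r rank hop h]
  exact hhop.sinkDist ((I.isSent_iff r rank hop t j).1 h).2.1
    (I.reachable_priorityGreedy r rank hop hhop hreach t j)

theorem sinkDist_priorityGreedy_antitone (hhop : I.IsShortestPathRule hop)
    (hreach : ∀ j, I.graph.Reachable (I.origin j) I.sink) (j : J) :
    Antitone fun t => I.sinkDist (I.priorityGreedy r rank hop t j) := by
  refine antitone_nat_of_succ_le fun t => ?_
  by_cases h : I.IsSent r rank hop t j
  · have := I.sinkDist_priorityGreedy_of_isSent r rank hop hhop hreach h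
    omega
  · rw [I.priorityGreedy_succ_of_not_isSent r rank hop h]

theorem not_interfere_of_isSent {rank : J → ℕ} (hrank : Function.Injective rank) {t : ℕ} {j k : J}
    (hjk : j ≠ k) (hj : I.IsSent r rank hop t j) (hk : I.IsSent r rank hop t k) :
    ¬ I.Interfere (call (I.priorityGreedy r rank hop) t j)
      (call (I.priorityGreedy r rank hop) t k) := by
  simp only [call, I.priorityGreedy_succ_of_isSent r rank hop hj,
    I.priorityGreedy_succ_of_isSent r rank hop hk]
  rcases lt_or_gt_of_ne (hrank.ne hjk) with h | h
  · exact ((I.isSent_iff r rank hop t k).1 hk).2.2 j h hj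
  · rw [interfere_comm]
    exact ((I.isSent_iff r rank hop t j).1 hj).2.2 k h hk

/-- An available packet that is not sent is blocked by a packet of higher priority, and is at most
`dI + 1` farther from the sink than that packet. -/
theorem exists_blocking (hhop : I.IsShortestPathRule hop)
    (hreach : ∀ j, I.graph.Reachable (I.origin j) I.sink) {t : ℕ} {j : J} (hr : r j ≤ t)
    (hs : I.priorityGreedy r rank hop t j ≠ I.sink) (h : ¬ I.IsSent r rank hop t j) :
    ∃ k, rank k < rank j ∧ I.IsSent r rank hop t k ∧
      I.sinkDist (I.priorityGreedy r rank hop t j) ≤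
        I.sinkDist (I.priorityGreedy r rank hop t k) + I.dI + 1 := by
  have h' := h
  rw [isSent_iff] at h'
  push Not at h'
  obtain ⟨k, hkj, hk, hint⟩ := h' hr hs
  refine ⟨k, hkj, hk, ?_⟩
  have hRj := I.reachable_priorityGreedy r rank hop hhop hreach t j
  have hRk := I.reachable_priorityGreedy r rank hop hhop hreach t k
  have hsk := ((I.isSent_iff r rank hop t k).1 hk).2.1
  have hdj := hhop.sinkDist (t := t) (j := j) hs hRj
  have hdk := hhop.sinkDist (t := t) (j := k) hsk hRk
  rcases hint with hint | hint
  · have := I.sinkDist_le_add hRj (hhop.reachable hsk hRk) hint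
    omega
  · have := I.sinkDist_le_add (hhop.reachable hs hRj) hRk (by rwa [SimpleGraph.edist_comm])
    omega

/-! ### Blocking chains -/

/-- A set `K` of packets through which a delay may be passed on from the packet `i` of highest
priority in `K` to the packet `j` of lowest priority in `K`. The packet `i` does not originate at the
sink. -/
structure IsBlockingChain (K : Finset J) (i j : J) : Prop where
  first_mem : i ∈ K
  last_mem : j ∈ K
  delta_pos : 0 < I.delta i
  first_le : ∀ k ∈ K, rank i ≤ rank k
  le_last : ∀ k ∈ K, rank k ≤ rank j

open Classical in
/-- The round by which the last packet of the blocking chain `K` with first packet `i` is at the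
sink, provided that the packets of `K` are delayed only by each other. -/
noncomputable def chainBound (K : Finset J) (i : J) : ℕ :=
  ⌈r i⌉₊ + I.delta i + ∑ k ∈ K.erase i, min (I.delta k) I.gamma

variable {I rank} in
theorem IsBlockingChain.singleton {j : J} (h : 0 < I.delta j) :
    I.IsBlockingChain rank {j} j j := by
  constructor <;> simp [h]

open Classical in
variable {I rank} in
theorem IsBlockingChain.insert {K : Finset J} {i k j : J} (h : I.IsBlockingChain rank K i k)
    (hkj : rank k < rank j) : I.IsBlockingChain rank (insert j K) i j where
  first_mem := Finset.mem_insert_of_mem h.first_mem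
  last_mem := Finset.mem_insert_self j K
  delta_pos := h.delta_pos
  first_le := by
    simp only [Finset.forall_mem_insert]
    exact ⟨(h.first_le k h.last_mem).trans hkj.le, h.first_le⟩
  le_last := by
    simp only [Finset.forall_mem_insert]
    exact ⟨le_rfl, fun a ha => (h.le_last a ha).trans hkj.le⟩

open Classical in
variable {I rank} in
theorem IsBlockingChain.chainBound_insert {K : Finset J} {i k j : J}
    (h : I.IsBlockingChain rank K i k) (hkj : rank k < rank j) :
    I.chainBound r (Insert.insert j K) i = I.chainBound r K i + min (I.delta j) I.gamma := by
  have hj : j ∉ K := fun hj => absurd (h.le_last j hj) (not_le.2 hkj)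
  have hij : i ≠ j := fun hij => hj (hij ▸ h.first_mem)
  unfold chainBound
  rw [Finset.erase_insert_of_ne hij.symm,
    Finset.sum_insert (fun hm => hj (Finset.mem_of_mem_erase hm))]
  ring

/-- A bound `B` for all blocking chains that end at `j` bounds the arrival of `j` under Priority
Greedy. The quantity `max t ⌈r j⌉ + (distance of j from the sink before round t)` is the round in
which `j` arrives if it is not blocked any more; it grows only in rounds in which `j` is blocked. The
slack `c` makes room for the packets that are appended to a chain when the induction on the priority
passes to a blocking packet. -/
theorem priorityGreedy_arrival_aux (hhop : I.IsShortestPathRule hop)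
    (hreach : ∀ j, I.graph.Reachable (I.origin j) I.sink) (B : ℕ) (j : J) (c : ℕ)
    (hB : ∀ K i, I.IsBlockingChain rank K i j → I.chainBound r K i + c ≤ B) (t : ℕ) :
    I.sinkDist (I.priorityGreedy r rank hop t j) = 0 ∨
      max t ⌈r j⌉₊ + I.sinkDist (I.priorityGreedy r rank hop t j) + c ≤ B := by
  classical
  induction hn : rank j using Nat.strong_induction_on generalizing j c t with
  | _ n IH =>
  subst hn
  rcases Nat.eq_zero_or_pos (I.delta j) with h0 | hpos
  · left
    have := I.sinkDist_priorityGreedy_antitone r rank hop hhop hreach j (Nat.zero_le t)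
    exact Nat.eq_zero_of_le_zero (this.trans h0.le)
  induction t with
  | zero =>
    right
    have := hB {j} j (.singleton hpos)
    simp only [chainBound, Finset.erase_singleton, Finset.sum_empty, add_zero] at this
    simpa [priorityGreedy, delta] using this
  | succ t ih =>
    by_cases h : I.IsSent r rank hop t j
    · have hd := I.sinkDist_priorityGreedy_of_isSent r rank hop hhop hreach h
      have hc : ⌈r j⌉₊ ≤ t := Nat.ceil_le.2 ((I.isSent_iff r rank hop t j).1 h).1
      rw [max_eq_left hc] at ih
      rw [max_eq_left (hc.trans t.le_succ)]
      omega
    rw [I.priorityGreedy_succ_of_not_isSent r rank hop h]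
    rcases ih with ih | ih
    · exact Or.inl ih
    by_cases hs : I.priorityGreedy r rank hop t j = I.sink
    · left
      rw [hs, sinkDist_sink]
    right
    rcases lt_or_ge t ⌈r j⌉₊ with ht | ht
    · rwa [max_eq_right ht.le, ← max_eq_right (a := t + 1) ht] at ih
    obtain ⟨k, hkj, hk, hd⟩ := I.exists_blocking r rank hop hhop hreach (Nat.ceil_le.1 ht) hs h
    have hk' := (I.isSent_iff r rank hop t k).1 hk
    have hk0 : I.sinkDist (I.priorityGreedy r rank hop t k) ≠ 0 := fun h0 =>
      hk'.2.1 ((I.sinkDist_eq_zero (I.reachable_priorityGreedy r rank hop hhop hreach t k)).1 h0)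
    have hkB := (IH (rank k) hkj k (min (I.delta j) I.gamma + c) (fun K i hK => by
      have := hB _ i (hK.insert hkj)
      rw [hK.chainBound_insert r hkj] at this
      omega) t rfl).resolve_left hk0
    rw [max_eq_left (Nat.ceil_le.2 hk'.1)] at hkB
    rw [max_eq_left (ht.trans t.le_succ)]
    have hδ : I.sinkDist (I.priorityGreedy r rank hop t j) ≤ I.delta j :=
      I.sinkDist_priorityGreedy_antitone r rank hop hhop hreach j (Nat.zero_le t)
    have hγ : I.gamma = I.dI + 2 := rfl
    rcases min_choice (I.delta j) I.gamma with hm | hm <;> rw [hm] at hkB <;> omega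

/-- A packet has arrived under Priority Greedy as soon as the number of completed rounds is at least
the bound of every blocking chain that ends at it. -/
theorem priorityGreedy_arrival (hhop : I.IsShortestPathRule hop)
    (hreach : ∀ j, I.graph.Reachable (I.origin j) I.sink) {B : ℕ} {j : J}
    (hB : ∀ K i, I.IsBlockingChain rank K i j → I.chainBound r K i ≤ B) :
    I.priorityGreedy r rank hop B j = I.sink := by
  rw [← I.sinkDist_eq_zero (I.reachable_priorityGreedy r rank hop hhop hreach B j)]
  have := I.priorityGreedy_arrival_aux r rank hop hhop hreach B j 0 hB B
  have := le_max_left B ⌈r j⌉₊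
  omega

theorem exists_priorityGreedy_eq_sink [Finite J] (hhop : I.IsShortestPathRule hop)
    (hreach : ∀ j, I.graph.Reachable (I.origin j) I.sink) (j : J) :
    ∃ t, I.priorityGreedy r rank hop t j = I.sink := by
  obtain ⟨B, hB⟩ := (Set.finite_range fun p : Finset J × J => I.chainBound r p.1 p.2).bddAbove
  exact ⟨B, I.priorityGreedy_arrival r rank hop hhop hreach fun K i _ => hB ⟨(K, i), rfl⟩⟩

end Greedy

theorem isFeasible_sigmaFIFO [Finite J] (I : WGP V J)
    (hreach : ∀ j, I.graph.Reachable (I.origin j) I.sink) {σ : ℝ} (hσ : 0 < σ)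
    {rank : J → ℕ} (hrank : Function.Injective rank)
    {hop : ℕ → J → V → V} (hhop : I.IsShortestPathRule hop) :
    I.IsFeasible σ (I.sigmaFIFO σ rank hop) where
  start _ := rfl
  adj t j h := by
    have hs := I.isSent_of_moves _ rank hop h
    have := (hhop t j _ ((I.isSent_iff _ rank hop t j).1 hs).2.1
      (I.reachable_priorityGreedy _ rank hop hhop hreach t j)).1
    rwa [← I.priorityGreedy_succ_of_isSent _ rank hop hs] at this
  released t j h := by
    have hs := ((I.isSent_iff _ rank hop t j).1 (I.isSent_of_moves _ rank hop h)).1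
    rw [le_div_iff₀ hσ, mul_comm]
    exact hs
  compatible t j k hjk hj hk :=
    I.not_interfere_of_isSent _ hop hrank hjk (I.isSent_of_moves _ rank hop hj)
      (I.isSent_of_moves _ rank hop hk)
  delivered := I.exists_priorityGreedy_eq_sink _ rank hop hhop hreach

/-! ### Lower bounds for unaugmented schedules -/

section LowerBound

variable {I : WGP V J} {x : ℕ → J → V}

theorem IsFeasible.release_le (hx : I.IsFeasible 1 x) {t : ℕ} {j : J} (h : Moves x t j) :
    I.release j ≤ t := by
  have := hx.released t j h
  rw [div_one] at this
  exact_mod_cast this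

theorem IsFeasible.reachable {σ : ℝ} (hx : I.IsFeasible σ x)
    (hreach : ∀ j, I.graph.Reachable (I.origin j) I.sink) (t : ℕ) (j : J) :
    I.graph.Reachable (x t j) I.sink := by
  induction t with
  | zero => rw [hx.start]; exact hreach j
  | succ t ih =>
    by_cases h : Moves x t j
    · exact (hx.adj t j h).reachable.symm.trans ih
    · rwa [not_not.1 h]

theorem IsFeasible.sinkDist_le_succ {σ : ℝ} (hx : I.IsFeasible σ x)
    (hreach : ∀ j, I.graph.Reachable (I.origin j) I.sink) (t : ℕ) (j : J) :
    I.sinkDist (x t j) ≤ I.sinkDist (x (t + 1) j) + 1 := by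
  by_cases h : Moves x t j
  · exact I.sinkDist_le_succ_of_adj (hx.reachable hreach t j) (hx.adj t j h)
  · rw [not_not.1 h]
    exact Nat.le_succ _

theorem IsFeasible.delta_le (hx : I.IsFeasible 1 x)
    (hreach : ∀ j, I.graph.Reachable (I.origin j) I.sink) (t : ℕ) (j : J) :
    I.delta j ≤ I.sinkDist (x t j) + (t - I.release j) := by
  induction t with
  | zero => rw [hx.start]; exact Nat.le_add_right _ _
  | succ t ih =>
    by_cases h : Moves x t j
    · have := hx.release_le h
      have := hx.sinkDist_le_succ hreach t j
      omega
    · rw [not_not.1 h]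
      omega

theorem IsFeasible.release_add_delta_le (hx : I.IsFeasible 1 x)
    (hreach : ∀ j, I.graph.Reachable (I.origin j) I.sink) {t : ℕ} {j : J}
    (ht : I.release j ≤ t) (h : x t j = I.sink) : I.release j + I.delta j ≤ t := by
  have := hx.delta_le hreach t j
  rw [h, sinkDist_sink] at this
  omega

/-- The rounds before `T` in which packet `j` comes one step closer to the sink, from a node at
distance at most `γ₀`. -/
noncomputable def criticalRounds (I : WGP V J) (x : ℕ → J → V) (T : ℕ) (j : J) : Finset ℕ :=
  {t ∈ Finset.range T | I.sinkDist (x (t + 1) j) + 1 = I.sinkDist (x t j) ∧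
    I.sinkDist (x t j) ≤ I.gammaZero}

theorem moves_of_mem_criticalRounds {T t : ℕ} {j : J} (h : t ∈ I.criticalRounds x T j) :
    Moves x t j := by
  simp only [criticalRounds, Finset.mem_filter] at h
  intro he
  rw [he] at h
  omega

/-- Two packets have no critical round in common: the calls `(u, v)` and `(u', v')` would satisfy
`d(u', v) ≤ γ₀ + (γ₀ - 1) ≤ dI`. -/
theorem IsFeasible.disjoint_criticalRounds {σ : ℝ} (hx : I.IsFeasible σ x)
    (hreach : ∀ j, I.graph.Reachable (I.origin j) I.sink) (T : ℕ) {j k : J} (hjk : j ≠ k) :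
    Disjoint (I.criticalRounds x T j) (I.criticalRounds x T k) := by
  rw [Finset.disjoint_left]
  intro t hj hk
  refine hx.compatible t j k hjk (moves_of_mem_criticalRounds hj)
    (moves_of_mem_criticalRounds hk) (Or.inl ?_)
  refine (I.edist_le_sinkDist_add (hx.reachable hreach t k)
    (hx.reachable hreach (t + 1) j)).trans ?_
  simp only [criticalRounds, Finset.mem_filter] at hj hk
  have hγ₀ : I.gammaZero = (I.dI + 1) / 2 := rfl
  exact_mod_cast (by omega : I.sinkDist (x t k) + I.sinkDist (x (t + 1) j) ≤ I.dI)

theorem IsFeasible.min_le_card_criticalRounds {σ : ℝ} (hx : I.IsFeasible σ x)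
    (hreach : ∀ j, I.graph.Reachable (I.origin j) I.sink) {T : ℕ} {j : J}
    (h : ∃ t ≤ T, x t j = I.sink) :
    min (I.delta j) I.gammaZero ≤ (I.criticalRounds x T j).card := by
  classical
  obtain ⟨t₀, ht₀, hs⟩ := h
  -- Every distance `a` with `1 ≤ a ≤ min (δ j) γ₀` is left downwards in some critical round.
  have hsub : Finset.Icc 1 (min (I.delta j) I.gammaZero) ⊆
      (I.criticalRounds x T j).image fun t => I.sinkDist (x t j) := by
    intro a ha
    rw [Finset.mem_Icc, le_min_iff] at ha
    have hex : ∃ t, I.sinkDist (x t j) < a := ⟨t₀, by rw [hs, sinkDist_sink]; omega⟩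
    have hle : Nat.find hex ≤ t₀ := Nat.find_min' hex (by rw [hs, sinkDist_sink]; omega)
    have hlt := Nat.find_spec hex
    obtain ⟨t, ht⟩ : ∃ t, Nat.find hex = t + 1 := by
      refine Nat.exists_eq_succ_of_ne_zero fun h0 => ?_
      rw [h0, hx.start] at hlt
      exact absurd ha.2.1 (not_le.2 hlt)
    have hge := Nat.find_min hex (m := t) (by omega)
    rw [ht] at hlt
    have := hx.sinkDist_le_succ hreach t j
    simp only [Finset.mem_image, criticalRounds, Finset.mem_filter, Finset.mem_range]
    exact ⟨t, ⟨by omega, by omega, by omega⟩, by omega⟩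
  have := (Finset.card_le_card hsub).trans Finset.card_image_le
  simpa using this

/-- In an unaugmented schedule, packets `k ∈ K` released at time `R` or later are not all delivered
before time `R + ∑ k ∈ K, min (δ k) γ₀`. -/
theorem IsFeasible.add_sum_le (hx : I.IsFeasible 1 x)
    (hreach : ∀ j, I.graph.Reachable (I.origin j) I.sink) {R T : ℕ} (hRT : R ≤ T) (K : Finset J)
    (hR : ∀ k ∈ K, R ≤ I.release k) (hT : ∀ k ∈ K, ∃ t ≤ T, x t k = I.sink) :
    R + ∑ k ∈ K, min (I.delta k) I.gammaZero ≤ T := by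
  classical
  have hsub : K.biUnion (I.criticalRounds x T) ⊆ Finset.Ico R T := by
    refine Finset.biUnion_subset.2 fun k hk t ht => ?_
    have h1 := (hR k hk).trans (hx.release_le (moves_of_mem_criticalRounds ht))
    simp only [criticalRounds, Finset.mem_filter, Finset.mem_range] at ht
    exact Finset.mem_Ico.2 ⟨h1, ht.1⟩
  have hcard := Finset.card_le_card hsub
  rw [Finset.card_biUnion fun j _ k _ hjk => hx.disjoint_criticalRounds hreach T hjk,
    Nat.card_Ico] at hcard
  have := Finset.sum_le_sum fun k hk => hx.min_le_card_criticalRounds hreach (hT k hk)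
  omega

/-- In an unaugmented schedule completion times are attained and are natural numbers. -/
theorem IsFeasible.exists_completionTime (hx : I.IsFeasible 1 x) (j : J) :
    ∃ n : ℕ, I.completionTime 1 x j = n ∧ I.release j ≤ n ∧ x n j = I.sink := by
  classical
  have hex : ∃ n, I.release j ≤ n ∧ x n j = I.sink := by
    obtain ⟨t, ht⟩ := hx.delivered j
    rcases le_total (I.release j) t with h | h
    · exact ⟨t, h, ht⟩
    · -- Packets do not move before their release dates.
      refine ⟨I.release j, le_rfl, ?_⟩
      have hconst : ∀ m, m ≤ I.release j → x m j = x 0 j := by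
        intro m
        induction m with
        | zero => exact fun _ => rfl
        | succ m ih =>
          intro hm
          by_contra hne
          rw [← ih (by omega)] at hne
          exact absurd (hx.release_le hne) (by omega)
      rw [hconst _ le_rfl, ← hconst t h, ht]
  refine ⟨Nat.find hex, ?_, Nat.find_spec hex⟩
  refine IsLeast.csInf_eq ⟨?_, ?_⟩
  · have h := Nat.find_spec hex
    refine ⟨by exact_mod_cast h.1, ?_⟩
    rw [one_mul, Nat.floor_natCast]
    exact h.2
  · rintro τ ⟨h1, h2⟩
    rw [one_mul] at h2
    have hτ : (0 : ℝ) ≤ τ := (Nat.cast_nonneg _).trans h1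
    have hfind : Nat.find hex ≤ ⌊τ⌋₊ := Nat.find_min' hex ⟨Nat.le_floor h1, h2⟩
    exact (Nat.cast_le.2 hfind).trans (Nat.floor_le hτ)

end LowerBound

/-! ### Comparison -/

theorem min_gamma_le (I : WGP V J) (j : J) :
    ((min (I.delta j) I.gamma : ℕ) : ℝ) ≤
      (I.gamma : ℝ) / I.gammaZero * ((min (I.delta j) I.gammaZero : ℕ) : ℝ) := by
  have h0 : (0 : ℝ) < I.gammaZero := by exact_mod_cast I.gammaZero_pos
  have hle : I.gammaZero ≤ I.gamma := by unfold gammaZero gamma; omega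
  rw [div_mul_eq_mul_div, le_div_iff₀ h0, ← Nat.cast_mul, ← Nat.cast_mul, Nat.cast_le]
  rcases le_total (I.delta j) I.gammaZero with h | h
  · rw [min_eq_left h, min_eq_left (h.trans hle), mul_comm]
    exact Nat.mul_le_mul_right _ hle
  · rw [min_eq_right h]
    exact Nat.mul_le_mul_right _ (min_le_right _ _)

/-- If an unaugmented schedule has delivered all packets of a blocking chain by time `T`, the chain
delays FIFO, run with the release dates `σ r`, at most until round `σ T`. -/
theorem IsBlockingChain.chainBound_le_mul {I : WGP V J}
    (hreach : ∀ j, I.graph.Reachable (I.origin j) I.sink)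
    {σ : ℝ} (hσ : (I.gamma : ℝ) / (I.gammaZero : ℝ) + 1 ≤ σ)
    {rank : J → ℕ} {x : ℕ → J → V} (hx : I.IsFeasible 1 x) {K : Finset J} {i j : J}
    (hK : I.IsBlockingChain rank K i j) (hrel : ∀ k ∈ K, I.release i ≤ I.release k) {T : ℕ}
    (hT : ∀ k ∈ K, ∃ t ≤ T, I.release k ≤ t ∧ x t k = I.sink) :
    (I.chainBound (I.scaledRelease σ) K i : ℝ) ≤ σ * T := by
  classical
  have h0 : (0 : ℝ) < I.gammaZero := by exact_mod_cast I.gammaZero_pos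
  set q : ℝ := (I.gamma : ℝ) / I.gammaZero with hq
  have hq1 : 1 ≤ q := by
    rw [hq, one_le_div h0, Nat.cast_le]
    unfold gammaZero gamma
    omega
  obtain ⟨t, htT, hrt, hts⟩ := hT i hK.first_mem
  have h1 : I.release i + I.delta i ≤ T :=
    (hx.release_add_delta_le hreach hrt hts).trans htT
  have h2 := hx.add_sum_le hreach (hrt.trans htT) K hrel
    fun k hk => (hT k hk).imp fun t ht => ⟨ht.1, ht.2.2⟩
  rw [← Finset.add_sum_erase K _ hK.first_mem] at h2
  have hmin : 1 ≤ min (I.delta i) I.gammaZero := le_min hK.delta_pos I.gammaZero_pos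
  have h3 : I.release i + (1 + ∑ k ∈ K.erase i, min (I.delta k) I.gammaZero) ≤ T := by omega
  have hsum : ((∑ k ∈ K.erase i, min (I.delta k) I.gamma : ℕ) : ℝ) ≤
      q * ((∑ k ∈ K.erase i, min (I.delta k) I.gammaZero : ℕ) : ℝ) := by
    rw [Nat.cast_sum, Nat.cast_sum, Finset.mul_sum]
    exact Finset.sum_le_sum fun k _ => I.min_gamma_le k
  have hceil : (⌈I.scaledRelease σ i⌉₊ : ℝ) ≤ σ * I.release i + 1 :=
    (Nat.ceil_lt_add_one (mul_nonneg (by linarith) (Nat.cast_nonneg _))).le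
  unfold chainBound
  rw [Nat.cast_add, Nat.cast_add]
  generalize (∑ k ∈ K.erase i, min (I.delta k) I.gammaZero : ℕ) = S at h3 hsum
  generalize (∑ k ∈ K.erase i, min (I.delta k) I.gamma : ℕ) = S' at hsum ⊢
  have h1' : (I.release i : ℝ) + I.delta i ≤ T := by exact_mod_cast h1
  have h3' : (I.release i : ℝ) + (1 + S) ≤ T := by exact_mod_cast h3
  have hTr : (0 : ℝ) ≤ T - I.release i := by
    have : (0 : ℝ) ≤ I.delta i := Nat.cast_nonneg _
    linarith
  -- The rounding of `σ r` costs at most one round, which is paid for by the first critical call of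
  -- packet `i`, as the latter counts `q ≥ 1` times.
  have h4 : q * (1 + S) ≤ q * (T - I.release i) :=
    mul_le_mul_of_nonneg_left (by linarith) (by linarith)
  have h5 : (q + 1) * (T - I.release i) ≤ σ * (T - I.release i) :=
    mul_le_mul_of_nonneg_right hσ hTr
  linarith

theorem completionTime_le {I : WGP V J} {σ : ℝ} {x : ℕ → J → V} {j : J} {τ : ℝ}
    (hr : (I.release j : ℝ) ≤ τ) (h : x ⌊σ * τ⌋₊ j = I.sink) : I.completionTime σ x j ≤ τ :=
  csInf_le ⟨I.release j, fun _ h => h.1⟩ ⟨hr, h⟩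

/-- The completion time of `j` under `σ`-FIFO is at most the completion time, in a given unaugmented
schedule, of some packet released no later than `j`. -/
theorem exists_completionTime_sigmaFIFO_le [Finite J] {I : WGP V J}
    (hreach : ∀ j, I.graph.Reachable (I.origin j) I.sink)
    {σ : ℝ} (hσ : (I.gamma : ℝ) / (I.gammaZero : ℝ) + 1 ≤ σ)
    {rank : J → ℕ} (hrank : IsFIFORank (I.scaledRelease σ) rank)
    {hop : ℕ → J → V → V} (hhop : I.IsShortestPathRule hop)
    {x : ℕ → J → V} (hx : I.IsFeasible 1 x) (j : J) :
    ∃ k, I.release k ≤ I.release j ∧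
      I.completionTime σ (I.sigmaFIFO σ rank hop) j ≤ I.completionTime 1 x k := by
  have hσ0 : 0 < σ := by
    have : (0 : ℝ) ≤ (I.gamma : ℝ) / I.gammaZero := by positivity
    linarith
  have hrel : ∀ a b, rank a ≤ rank b → I.release a ≤ I.release b := by
    intro a b hab
    by_contra hlt
    refine absurd (hrank.2 b a ?_) (not_lt.2 hab)
    exact mul_lt_mul_of_pos_left (by exact_mod_cast not_le.1 hlt) hσ0
  choose n hn hrn hsn using fun k => hx.exists_completionTime k
  obtain ⟨k, hk, hmax⟩ := Set.exists_max_image {k | rank k ≤ rank j} n (Set.toFinite _)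
    ⟨j, le_refl (rank j)⟩
  refine ⟨k, hrel k j hk, ?_⟩
  rw [hn k]
  refine completionTime_le ?_ ?_
  · exact_mod_cast (hrn j).trans (hmax j (le_refl (rank j)))
  · refine I.priorityGreedy_arrival _ rank hop hhop hreach fun K i hK => Nat.le_floor ?_
    exact hK.chainBound_le_mul hreach hσ hx (fun a ha => hrel i a (hK.first_le a ha))
      fun a ha => ⟨n a, hmax a (hK.le_last a ha), hrn a, hsn a⟩

end WGP

theorem mainTheorem1 {V J : Type*} [Finite J] (I : WGP V J)
    (hreach : ∀ j, I.graph.Reachable (I.origin j) I.sink)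
    (σ : ℝ) (hσ : (I.gamma : ℝ) / (I.gammaZero : ℝ) + 1 ≤ σ)
    (rank : J → ℕ) (hrank : WGP.IsFIFORank (I.scaledRelease σ) rank)
    (hop : ℕ → J → V → V) (hhop : I.IsShortestPathRule hop) :
    I.IsFeasible σ (I.sigmaFIFO σ rank hop) ∧
    (∀ x : ℕ → J → V, I.IsFeasible 1 x →
      I.maxCompletionTime σ (I.sigmaFIFO σ rank hop) ≤ I.maxCompletionTime 1 x) ∧
    (∀ x : ℕ → J → V, I.IsFeasible 1 x →
      I.maxFlowTime σ (I.sigmaFIFO σ rank hop) ≤ I.maxFlowTime 1 x) := by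
  have hσ0 : 0 < σ := by
    have : (0 : ℝ) ≤ (I.gamma : ℝ) / I.gammaZero := by positivity
    linarith
  refine ⟨I.isFeasible_sigmaFIFO hreach hσ0 hrank.1 hhop, fun x hx => ?_, fun x hx => ?_⟩
  · cases isEmpty_or_nonempty J
    · simp [WGP.maxCompletionTime]
    · refine ciSup_le fun j => ?_
      obtain ⟨k, -, hk⟩ := WGP.exists_completionTime_sigmaFIFO_le hreach hσ hrank hhop hx j
      exact hk.trans (le_ciSup (f := fun k => I.completionTime 1 x k)
        (Set.finite_range _).bddAbove k)
  · cases isEmpty_or_nonempty J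
    · simp [WGP.maxFlowTime]
    · refine ciSup_le fun j => ?_
      obtain ⟨k, hkj, hk⟩ := WGP.exists_completionTime_sigmaFIFO_le hreach hσ hrank hhop hx j
      have hkj' : (I.release k : ℝ) ≤ I.release j := by exact_mod_cast hkj
      refine le_trans ?_ (le_ciSup (f := fun k => I.flowTime 1 x k)
        (Set.finite_range _).bddAbove k)
      exact sub_le_sub hk hkj'
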